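/- **Setting.** Let $d=|U^i|+|U^c|+|U^n|$, $U=[U^i,U^c,U^n]\in\mathbb R^{d}$, and let $\mathcal V$ be the set of values of the neighbours' covariates $X_{\mathcal N}$. A model $\theta$ consists of a latent space $\mathcal U=I_1\times\dots\times I_d$ (a product of nonempty open intervals, possibly unbounded), a mixing function $f:\mathcal U\to\mathbb R^D$, and a prior density on $\mathcal U$ $$p_\theta(u\mid v)=\frac{Q(u)}{C(v)}\exp\big(T(u)^{\top}\lambda(v)\big),\qquad v\in\mathcal V,$$ where $Q>0$ on $\mathcal U$, $\lambda$ is an arbitrary function, $C(v)=\int_{\mathcal U}Q\,e^{T^\top\lambda(v)}<\infty$, and $T(u)=[T_1(u_1),\dots,T_d(u_d),T_{\rm MLP}(u)]$. Here each $T_j:I_j\to\mathbb R^{k_j}$ has dimension $k_j\ge 2$, this dimension being genuine: on no nonempty open subinterval of $I_j$ do the components of $T_j$ satisfy a nontrivial affine relation. $T_{\rm MLP}$ is the output of a ReLU multilayer perceptron. Let $k$ be the dimension of $T$. The observation is $X=f(U)+\varepsilon$, where $\varepsilon$ has a fixed probability density $p_\varepsilon$, so that $p_\theta(x\mid v)=\int_{\mathcal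 U}p_\varepsilon(x-f(u))\,p_\theta(u\mid v)\,du$. **Theorem.** Let $\theta$ (true) and $\tilde\theta$ (learned, marked by tildes) be two such models with the same $d$, $D$, $\mathcal V$ and $p_\varepsilon$. Suppose: 1. the characteristic function of $p_\varepsilon$ vanishes only on a Lebesgue null set; 2. each of $f,\tilde f$ is injective, has all second-order cross derivatives $\partial_s\partial_t$ ($s\neq t$), and is a $C^1$ embedding: it is $C^1$ with injective differential and its inverse is continuous on its range; moreover the sets of noise-free observations agree, $f(\mathcal U)=\tilde f(\tilde{\mathcal U})$; 3. all $T_j$ and $\tilde T_j$ are twice differentiable; 4. there are $k+1$ distinct values $v_0,\dots,v_k\in\mathcal V$ such that the $k\times k$ matrix $L=(\lambda(v_1)-\lambda(v_0),\dots,\lambda(v_k)-\lambda(v_0))$ is invertible. If $p_\theta(\cdot\mid v)=p_{\tilde\theta}(\cdot\mid v)$ almost everywhere for every $v\in\mathcal V$, then the latents $U^i,U^c,U^n$ are recovered up to a permutation and simple componentwise transformations. That is, there are a permutation $\sigma$ of the $d$ latent coordinates and bijections $h_j:I_j\to\tilde I_{\sigma(j)}$ that are $C^1$ with nowhere vanishing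 derivative, such that for every $u\in\mathcal U$ the recovered latent $\tilde u=\tilde f^{-1}(f(u))$ satisfies $$\tilde u_{\sigma(j)}=h_j(u_j)\qquad\text{for all } j;$$ and for each $j$ there are a matrix $A_j$ and vectors $a_j,c_j$ with $T_j(x)=A_j\tilde T_{\sigma(j)}(h_j(x))+h_j(x)\,a_j+c_j$ for all $x\in I_j$. -/

import Mathlib

open MeasureTheory Set
open scoped Matrix

noncomputable section

/-- Multilayer perceptrons with ReLU activations: affine maps, and affine maps applied to the
coordinatewise rectification of a smaller perceptron. -/
inductive IsReLUMLP {ι : Type*} [Fintype ι] : (m : ℕ) → ((ι → ℝ) → (Fin m → ℝ)) → Prop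
  | affine {m : ℕ} (W : Matrix (Fin m) ι ℝ) (b : Fin m → ℝ) :
      IsReLUMLP m (fun u => W *ᵥ u + b)
  | layer {n m : ℕ} (g : (ι → ℝ) → (Fin n → ℝ)) (hg : IsReLUMLP n g)
      (W : Matrix (Fin m) (Fin n) ℝ) (b : Fin m → ℝ) :
      IsReLUMLP m (fun u => W *ᵥ (fun j => max (g u j) 0) + b)

/-- The parameters of the generative model `X = f(U) + ε`: the latent coordinates are indexed by
`ι`, the observations live in `ℝ^D`, and `V` is the set of values of the neighbours' covariates. -/
structure LatentModel (ι : Type*) [Fintype ι] (D : ℕ) (V : Type*) where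
  /-- the range of values of each latent coordinate -/
  I : ι → Set ℝ
  /-- the dimension of each coordinate's statistic -/
  dimT : ι → ℕ
  /-- the factorized sufficient statistics -/
  T : (i : ι) → ℝ → (Fin (dimT i) → ℝ)
  /-- the output dimension of the perceptron -/
  dimMLP : ℕ
  /-- the perceptron part of the sufficient statistics -/
  TMLP : (ι → ℝ) → (Fin dimMLP → ℝ)
  /-- the natural parameters -/
  lam : V → ((Σ i, Fin (dimT i)) ⊕ Fin dimMLP) → ℝ
  /-- the base measure (its density) -/
  Q : EuclideanSpace ℝ ι → ℝ
  /-- the mixing function -/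
  f : EuclideanSpace ℝ ι → EuclideanSpace ℝ (Fin D)

namespace LatentModel

variable {ι : Type*} [Fintype ι] {D : ℕ} {V : Type*}

/-- The index set of all sufficient statistics; its cardinality is the dimension `k`. -/
abbrev StatIdx (θ : LatentModel ι D V) : Type _ := (Σ i, Fin (θ.dimT i)) ⊕ Fin θ.dimMLP

/-- The latent space, the product of the ranges of the coordinates. -/
def latentSpace (θ : LatentModel ι D V) : Set (EuclideanSpace ℝ ι) := {u | ∀ i, u i ∈ θ.I i}

/-- All sufficient statistics, the factorized ones followed by the perceptron. -/
def stat (θ : LatentModel ι D V) (u : EuclideanSpace ℝ ι) : θ.StatIdx → ℝ :=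
  Sum.elim (fun p => θ.T p.1 (u p.1) p.2) (θ.TMLP (fun i => u i))

/-- The prior before normalization. -/
def weight (θ : LatentModel ι D V) (v : V) (u : EuclideanSpace ℝ ι) : ℝ :=
  θ.Q u * Real.exp (θ.stat u ⬝ᵥ θ.lam v)

/-- The normalizing constant. -/
def normalizer (θ : LatentModel ι D V) (v : V) : ℝ := ∫ u in θ.latentSpace, θ.weight v u

/-- The prior density of the latents given the neighbours' covariates, on the latent space. -/
def prior (θ : LatentModel ι D V) (v : V) (u : EuclideanSpace ℝ ι) : ℝ :=
  θ.Q u / θ.normalizer v * Real.exp (θ.stat u ⬝ᵥ θ.lam v)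

/-- The density of the observation `X = f(U) + ε` given the neighbours' covariates, when the
noise has density `pε`. -/
def obsDensity (θ : LatentModel ι D V) (pε : EuclideanSpace ℝ (Fin D) → ℝ) (v : V)
    (x : EuclideanSpace ℝ (Fin D)) : ENNReal :=
  ∫⁻ u in θ.latentSpace, ENNReal.ofReal (pε (x - θ.f u) * θ.prior v u)

/-- The prior is an exponential family with positive density on a product of open intervals,
whose statistics are genuinely multivariate factorized statistics (no affine relation between the
components on any open interval) together with a ReLU perceptron. -/
structure IsExpFamily (θ : LatentModel ι D V) : Prop where
  isOpen_I : ∀ i, IsOpen (θ.I i)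
  ordConnected_I : ∀ i, (θ.I i).OrdConnected
  nonempty_I : ∀ i, (θ.I i).Nonempty
  Q_pos : ∀ u ∈ θ.latentSpace, 0 < θ.Q u
  normalizable : ∀ v, IntegrableOn (θ.weight v) θ.latentSpace
  two_le_dimT : ∀ i, 2 ≤ θ.dimT i
  minimal : ∀ i (a b : ℝ), a < b → Ioo a b ⊆ θ.I i → ∀ (c : Fin (θ.dimT i) → ℝ) (r : ℝ),
    (∀ x ∈ Ioo a b, c ⬝ᵥ θ.T i x = r) → c = 0
  mlp : IsReLUMLP θ.dimMLP θ.TMLP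

/-- The mixing function is injective with all second-order cross derivatives, and it is a
continuously differentiable parametrization of its range: its differential is injective and its
inverse is continuous. -/
structure IsRegularMixing [DecidableEq ι] (θ : LatentModel ι D V) : Prop where
  injOn : InjOn θ.f θ.latentSpace
  cross : ∀ s t : ι, s ≠ t → ∀ u ∈ θ.latentSpace,
    LineDifferentiableAt ℝ (fun w => lineDeriv ℝ θ.f w (EuclideanSpace.single t 1)) u
      (EuclideanSpace.single s 1)
  contDiffOn : ContDiffOn ℝ 1 θ.f θ.latentSpace
  immersion : ∀ u ∈ θ.latentSpace, Function.Injective (fderiv ℝ θ.f u)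
  inducing : Topology.IsInducing (θ.latentSpace.domRestrict θ.f)

/-- The factorized sufficient statistics are twice differentiable. -/
def TwiceDiffStat (θ : LatentModel ι D V) : Prop :=
  ∀ i, ∀ x ∈ θ.I i, DifferentiableAt ℝ (θ.T i) x ∧ DifferentiableAt ℝ (deriv (θ.T i)) x

/-- There are `k + 1` distinct values of the neighbours' covariates whose matrix of differences of
natural parameters, of size `k × k`, is invertible. -/
def SufficientVariability [DecidableEq ι] (θ : LatentModel ι D V) : Prop :=
  ∃ x : Option θ.StatIdx → V, Function.Injective x ∧
    IsUnit (Matrix.of fun s l : θ.StatIdx => θ.lam (x (some l)) s - θ.lam (x none) s)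

end LatentModel

/-- `p` is a probability density on `ℝ^D`. -/
structure IsProbDensity {D : ℕ} (p : EuclideanSpace ℝ (Fin D) → ℝ) : Prop where
  measurable : Measurable p
  nonneg : ∀ x, 0 ≤ p x
  lintegral_eq_one : ∫⁻ x, ENNReal.ofReal (p x) = 1

/-- The measure with density `p`. -/
def densityMeasure {D : ℕ} (p : EuclideanSpace ℝ (Fin D) → ℝ) :
    Measure (EuclideanSpace ℝ (Fin D)) :=
  volume.withDensity fun x => ENNReal.ofReal (p x)

end

/-!
The transition map `ψ = f⁻¹ ∘ f'` between the two latent spaces is a `C¹` diffeomorphism, because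
both mixing functions are `C¹` embeddings with the same range
(`exists_contDiffOn_transition`). Since the characteristic function of the noise is almost
everywhere nonzero, the noise can be removed (`eq_of_conv_eq_of_charFun_ne_zero`): the two priors
have the same image in the space of observations, so they correspond to each other under the
transition map by the change of variables formula (`ae_eq_det_mul_of_map_eq`). In differences of
log-densities for several values of the covariates the base measures and the Jacobian determinant
cancel, and invertibility of the matrix `L` yields `T (ψ w) = A T' w + b` on the whole latent space
(`LatentModel.exists_stat_eq_mulVec`).

For each `i`, this writes `T i (ψ w i)` as a sum of functions of one coordinate of `w` each, plus a
perceptron. A perceptron is a continuous selection of finitely many affine maps, hence affine near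
the points of a dense open set. There, if `ψ i` had two nonzero partial derivatives, in the
directions `s` and `t`, then `∂ₛ (T i ∘ ψ i)` would not depend on `w t`, so the vector `(T i)'`
would keep a fixed direction along an interval. As `T i` has at least two components and these
satisfy no affine relation, this is impossible
(`fderiv_mul_fderiv_eq_zero_of_mixed_difference`). This argument uses first derivatives only, and no
second derivatives of the mixing functions. By continuity every row of the Jacobian matrix of `ψ`
has at most one nonzero entry everywhere, and by connectedness the position of this entry is
constant, which gives the permutation and the componentwise maps (`exists_perm_componentwise`).

Varying one coordinate only, `T i` differs from an affine function of `T' (σ i) ∘ h i` by a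
perceptron of one variable. The latter is differentiable, being a difference of differentiable
functions, and its derivative takes finitely many values, so by Darboux's theorem it is affine
(`exists_affine_of_finite_selection`).
-/

/-! ### Perceptrons are continuous and piecewise affine -/

/-- A perceptron is a continuous selection of finitely many affine maps. -/
theorem IsReLUMLP.continuous_and_finite_affine {ι : Type*} [Fintype ι] {m : ℕ}
    {g : (ι → ℝ) → (Fin m → ℝ)} (hg : IsReLUMLP m g) :
    Continuous g ∧ ∃ S : Set (Matrix (Fin m) ι ℝ × (Fin m → ℝ)), S.Finite ∧
      ∀ u, ∃ p ∈ S, g u = p.1 *ᵥ u + p.2 := by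
  induction hg with
  | affine W b =>
    exact ⟨by fun_prop, {(W, b)}, finite_singleton _, fun u => ⟨(W, b), rfl, rfl⟩⟩
  | @layer n m g hg W b ih =>
    obtain ⟨hc, S, hS, hsel⟩ := ih
    refine ⟨by fun_prop, (fun q : (Matrix (Fin n) ι ℝ × (Fin n → ℝ)) × Set (Fin n) =>
      (W * Matrix.of fun j i => q.2.indicator 1 j * q.1.1 j i,
        W *ᵥ (fun j => q.2.indicator 1 j * q.1.2 j) + b)) '' (S ×ˢ univ),
      (hS.prod finite_univ).image _, fun u => ?_⟩
    obtain ⟨p, hp, hpu⟩ := hsel u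
    refine ⟨_, ⟨(p, {j | 0 ≤ g u j}), ⟨hp, mem_univ _⟩, rfl⟩, ?_⟩
    rw [← Matrix.mulVec_mulVec, ← add_assoc, ← Matrix.mulVec_add]
    refine congrArg (fun z => W *ᵥ z + b) (funext fun j => ?_)
    have hj : g u j = ∑ i, p.1 j i * u i + p.2 j := by rw [hpu]; rfl
    simp only [Pi.add_apply, Matrix.mulVec, dotProduct, Matrix.of_apply, mul_assoc,
      ← Finset.mul_sum, ← mul_add, ← hj]
    by_cases h : 0 ≤ g u j
    · simp [indicator, h]
    · simp [indicator, h, le_of_not_ge h]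

/-- A continuous selection of finitely many continuous maps agrees with one of them on a nonempty
open subset of any given nonempty open set. -/
theorem exists_open_eqOn_of_finite_selection {X Y κ : Type*} [TopologicalSpace X]
    [TopologicalSpace Y] [T2Space Y] {g : X → Y} (hg : Continuous g) {F : κ → X → Y}
    (hF : ∀ p, Continuous (F p)) {S : Set κ} (hS : S.Finite) :
    ∀ {O : Set X}, IsOpen O → O.Nonempty → (∀ u ∈ O, ∃ p ∈ S, g u = F p u) →
      ∃ p ∈ S, ∃ O' ⊆ O, IsOpen O' ∧ O'.Nonempty ∧ ∀ u ∈ O', g u = F p u := by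
  induction S, hS using Set.Finite.induction_on with
  | empty => rintro O - ⟨u, hu⟩ h; obtain ⟨p, hp, -⟩ := h u hu; exact hp.elim
  | @insert q S _ _ ih =>
    intro O hO hne h
    by_cases hall : ∀ u ∈ O, g u = F q u
    · exact ⟨q, mem_insert _ _, O, subset_rfl, hO, hne, hall⟩
    push Not at hall
    obtain ⟨u, huO, hu⟩ := hall
    obtain ⟨p, hp, O', hO', h'⟩ := ih (O := O ∩ {u | g u ≠ F q u})
      (hO.inter (isOpen_ne_fun hg (hF q))) ⟨u, huO, hu⟩ (by
        rintro w ⟨hw, hne⟩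
        obtain ⟨p, hp, hpw⟩ := h w hw
        rcases hp with rfl | hp
        · exact (hne hpw).elim
        · exact ⟨p, hp, hpw⟩)
    exact ⟨p, mem_insert_of_mem _ hp, O', hO'.trans inter_subset_left, h'⟩

/-- A differentiable function on an interval that selects from finitely many affine functions is
affine: by pigeonhole its derivative takes finitely many values, so it is constant by Darboux's
theorem. -/
theorem exists_affine_of_finite_selection {J : Set ℝ} (hJ : IsOpen J) (hJc : J.OrdConnected)
    {G : ℝ → ℝ} (hG : ∀ y ∈ J, DifferentiableAt ℝ G y) {S : Set (ℝ × ℝ)} (hS : S.Finite)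
    (hsel : ∀ y, ∃ p ∈ S, G y = y * p.1 + p.2) : ∃ a c, ∀ y ∈ J, G y = y * a + c := by
  rcases J.eq_empty_or_nonempty with rfl | ⟨y₀, hy₀⟩
  · exact ⟨0, 0, by simp⟩
  have hval : ∀ y ∈ J, ∃ p ∈ S, deriv G y = p.1 := by
    intro y hy
    have hfr : ∃ᶠ z in nhdsWithin y {y}ᶜ, ∃ p ∈ S, G z = z * p.1 + p.2 :=
      Filter.Eventually.frequently (Filter.Eventually.of_forall hsel)
    obtain ⟨p, hp, hfr⟩ : ∃ p ∈ S, ∃ᶠ z in nhdsWithin y {y}ᶜ, G z = z * p.1 + p.2 := by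
      by_contra hcon
      push Not at hcon
      exact hfr (((Filter.eventually_all_finite hS).2 hcon).mono fun z hz ⟨p, hp, h⟩ => hz p hp h)
    refine ⟨p, hp, ?_⟩
    have hA : HasDerivAt (fun z => G z - (z * p.1 + p.2)) (deriv G y - p.1) y := by
      have := ((hasDerivAt_id y).mul_const p.1).add_const p.2
      rw [one_mul] at this
      exact (hG y hy).hasDerivAt.sub this
    by_contra hne
    exact hfr ((hA.eventually_ne (c := 0) (sub_ne_zero.2 hne)).mono fun z hz h => hz (by simp [h]))
  have hsub : (deriv G '' J).Subsingleton := by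
    have hpc : IsPreconnected (deriv G '' J) :=
      (hJc.image_deriv hG).isPreconnected
    refine not_nontrivial_iff.1 fun hnt => hpc.infinite_of_nontrivial hnt ?_
    refine (hS.image Prod.fst).subset ?_
    rintro _ ⟨y, hy, rfl⟩
    obtain ⟨p, hp, h⟩ := hval y hy
    exact ⟨p, hp, h.symm⟩
  refine ⟨deriv G y₀, G y₀ - y₀ * deriv G y₀, fun y hy => ?_⟩
  have hd : ∀ z ∈ J, HasDerivAt (fun z => G z - z * deriv G y₀) 0 z := by
    intro z hz
    have h1 := (hG z hz).hasDerivAt.sub ((hasDerivAt_id z).mul_const (deriv G y₀))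
    rwa [hsub (mem_image_of_mem _ hz) (mem_image_of_mem _ hy₀), one_mul, sub_self] at h1
  have := hJ.is_const_of_deriv_eq_zero hJc.isPreconnected
    (fun z hz => (hd z hz).differentiableAt.differentiableWithinAt) (fun z hz => (hd z hz).deriv)
    hy hy₀
  linarith

/-! ### Transition maps between parametrizations -/

/-- If a `C¹` map `f` factors through a `C¹` immersion `f'` by a continuous map `φ`, then `φ` is
`C¹`: compose `f'` with a linear left inverse of its differential and invert locally. -/
theorem contDiffAt_of_immersion_comp {E E' F : Type*} [NormedAddCommGroup E] [NormedSpace ℝ E]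
    [NormedAddCommGroup E'] [NormedSpace ℝ E'] [FiniteDimensional ℝ E']
    [NormedAddCommGroup F] [NormedSpace ℝ F] [FiniteDimensional ℝ F]
    {f : E → F} {f' : E' → F} {φ : E → E'} {u : E} (hf : ContDiffAt ℝ 1 f u)
    (hf' : ContDiffAt ℝ 1 f' (φ u)) (himm : Function.Injective (fderiv ℝ f' (φ u)))
    (hφ : ContinuousAt φ u) (hcomp : ∀ᶠ w in nhds u, f' (φ w) = f w) :
    ContDiffAt ℝ 1 φ u := by
  have : CompleteSpace E' := FiniteDimensional.complete ℝ E'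
  obtain ⟨P, hP⟩ := LinearMap.exists_leftInverse_of_injective
    (fderiv ℝ f' (φ u) : E' →ₗ[ℝ] F) (LinearMap.ker_eq_bot.2 himm)
  set P' : F →L[ℝ] E' := LinearMap.toContinuousLinearMap P
  have hg : ContDiffAt ℝ 1 (fun w => P' (f' w)) (φ u) := P'.contDiff.contDiffAt.comp _ hf'
  have hg' : HasFDerivAt (fun w => P' (f' w))
      ((ContinuousLinearEquiv.refl ℝ E' : E' ≃L[ℝ] E') : E' →L[ℝ] E') (φ u) := by
    have := P'.hasFDerivAt.comp (φ u) (hf'.differentiableAt one_ne_zero).hasFDerivAt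
    refine this.congr_fderiv ?_
    ext z
    exact LinearMap.congr_fun hP z
  have hinv := hg.to_localInverse hg' one_ne_zero
  rw [hcomp.self_of_nhds] at hinv
  have hfin : ContDiffAt ℝ 1 (fun w => hg.localInverse hg' one_ne_zero (P' (f w))) u :=
    hinv.comp u (P'.contDiff.contDiffAt.comp u hf)
  refine hfin.congr_of_eventuallyEq ?_
  have hleft := (hg.hasStrictFDerivAt' hg' one_ne_zero).eventually_left_inverse
  filter_upwards [hφ.eventually hleft, hcomp] with w hw hw'
  rw [← hw']
  exact hw.symm

/-- A `C¹` map whose range lies in that of a `C¹` embedding factors through it by a `C¹` map. -/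
theorem exists_contDiffOn_transition {E E' F : Type*} [NormedAddCommGroup E] [NormedSpace ℝ E]
    [NormedAddCommGroup E'] [NormedSpace ℝ E'] [FiniteDimensional ℝ E']
    [NormedAddCommGroup F] [NormedSpace ℝ F] [FiniteDimensional ℝ F]
    {f : E → F} {f' : E' → F} {U : Set E} {U' : Set E'} (hU : IsOpen U) (hU' : IsOpen U')
    (hf : ContDiffOn ℝ 1 f U) (hf' : ContDiffOn ℝ 1 f' U')
    (himm : ∀ w ∈ U', Function.Injective (fderiv ℝ f' w))
    (hind : Topology.IsInducing (U'.domRestrict f')) (hrange : f '' U ⊆ f' '' U') :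
    ∃ φ : E → E', MapsTo φ U U' ∧ (∀ u ∈ U, f' (φ u) = f u) ∧ ContDiffOn ℝ 1 φ U := by
  have hex : ∀ u, ∃ w, u ∈ U → w ∈ U' ∧ f' w = f u := fun u => by
    by_cases hu : u ∈ U
    · obtain ⟨w, hw, h⟩ := hrange (mem_image_of_mem f hu)
      exact ⟨w, fun _ => ⟨hw, h⟩⟩
    · exact ⟨0, fun h => (hu h).elim⟩
  choose φ hφ using hex
  have hmaps : MapsTo φ U U' := fun u hu => (hφ u hu).1
  have hcont : ContinuousOn φ U := by
    rw [continuousOn_iff_continuous_domRestrict]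
    have : Continuous fun u : U => (⟨φ u, hmaps u.2⟩ : U') := by
      rw [hind.continuous_iff]
      refine (continuousOn_iff_continuous_domRestrict.1 hf.continuousOn).congr fun u => ?_
      exact ((hφ u u.2).2).symm
    exact continuous_subtype_val.comp this
  refine ⟨φ, hmaps, fun u hu => (hφ u hu).2, fun u hu => ?_⟩
  refine (contDiffAt_of_immersion_comp (hf.contDiffAt (hU.mem_nhds hu))
    (hf'.contDiffAt (hU'.mem_nhds (hmaps hu))) (himm _ (hmaps hu))
    (hcont.continuousAt (hU.mem_nhds hu)) ?_).contDiffWithinAt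
  filter_upwards [hU.mem_nhds hu] with w hw using (hφ w hw).2

/-! ### Statistics that separate the variables -/

/-- If `τ ∘ g` has vanishing mixed differences in the directions `a` and `b`, where `τ` takes values
in dimension at least two and satisfies no affine relation on any interval, then at most one of the
two directional derivatives of `g` is nonzero. Otherwise, moving in the direction `b`, the vector
`τ' (g w)` would keep a fixed direction while `g w` runs through an interval, and a covector
orthogonal to this direction would give an affine relation. -/
theorem fderiv_mul_fderiv_eq_zero_of_mixed_difference {E : Type*} [NormedAddCommGroup E]
    [NormedSpace ℝ E] {n : ℕ} (hn : 2 ≤ n) {N : Set E} (hN : IsOpen N) {g : E → ℝ}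
    (hg : ContDiffOn ℝ 1 g N) {τ : ℝ → Fin n → ℝ} {I : Set ℝ} (hgI : MapsTo g N I)
    (hτ : ∀ x ∈ I, DifferentiableAt ℝ τ x)
    (hmin : ∀ a b : ℝ, a < b → Ioo a b ⊆ I → ∀ (c : Fin n → ℝ) (r : ℝ),
      (∀ x ∈ Ioo a b, c ⬝ᵥ τ x = r) → c = 0) {a b : E}
    (hmix : ∀ w (x y : ℝ), w ∈ N → w + x • a ∈ N → w + y • b ∈ N → w + y • b + x • a ∈ N →
      τ (g (w + y • b + x • a)) + τ (g w) = τ (g (w + x • a)) + τ (g (w + y • b)))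
    {w : E} (hw : w ∈ N) : fderiv ℝ g w a * fderiv ℝ g w b = 0 := by
  by_contra hne
  obtain ⟨ha, hb⟩ := mul_ne_zero_iff.1 hne
  have hdir : ∀ {w : E}, w ∈ N → ∀ e : E,
      HasDerivAt (fun x : ℝ => g (w + x • e)) (fderiv ℝ g w e) 0 := fun {w} hw e => by
    have h1 : HasFDerivAt g (fderiv ℝ g w) (w + (0 : ℝ) • e) := by
      rw [zero_smul, add_zero]
      exact ((hg.contDiffAt (hN.mem_nhds hw)).differentiableAt one_ne_zero).hasFDerivAt
    have h2 : HasDerivAt (fun x : ℝ => w + x • e) e 0 := by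
      simpa using ((hasDerivAt_id (0 : ℝ)).smul_const e).const_add w
    exact h1.comp_hasDerivAt 0 h2
  have hτdir : ∀ {w : E}, w ∈ N → ∀ e : E, HasDerivAt (fun x : ℝ => τ (g (w + x • e)))
      (fderiv ℝ g w e • deriv τ (g w)) 0 := fun {w} hw e => by
    have h1 : HasDerivAt τ (deriv τ (g w)) (g (w + (0 : ℝ) • e)) := by
      rw [zero_smul, add_zero]
      exact (hτ _ (hgI hw)).hasDerivAt
    exact h1.scomp (0 : ℝ) (hdir hw e)
  have hline : ∀ {w : E}, w ∈ N → ∀ e : E, ∀ᶠ x : ℝ in nhds 0, w + x • e ∈ N :=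
    fun {w} hw e => by
      have hc : Continuous fun x : ℝ => w + x • e := by fun_prop
      exact hc.continuousAt.eventually_mem (by simpa using hN.mem_nhds hw)
  -- a covector annihilating `τ' (g w)` exists since the dimension is at least two
  obtain ⟨c, hc0, hc⟩ : ∃ c : Fin n → ℝ, c ≠ 0 ∧ c ⬝ᵥ deriv τ (g w) = 0 := by
    have := LinearMap.ker_ne_bot_of_finrank_lt
      (f := (dotProductBilin ℝ ℝ (m := Fin n)).flip (deriv τ (g w))) (by simpa using show 1 < n from hn)
    obtain ⟨c, hc, hc0⟩ := Submodule.exists_mem_ne_zero_of_ne_bot this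
    exact ⟨c, hc0, by simpa using hc⟩
  have hev : ∀ᶠ y : ℝ in nhds 0, w + y • b ∈ N ∧ c ⬝ᵥ deriv τ (g (w + y • b)) = 0 := by
    have hfd : ∀ᶠ y : ℝ in nhds 0, fderiv ℝ g (w + y • b) a ≠ 0 := by
      have h1 : ContinuousAt (fun z => fderiv ℝ g z a) (w + (0 : ℝ) • b) := by
        rw [zero_smul, add_zero]
        exact ((hg.continuousOn_fderiv_of_isOpen hN le_rfl).continuousAt
          (hN.mem_nhds hw)).clm_apply continuousAt_const
      have h2 : ContinuousAt (fun y : ℝ => w + y • b) 0 := by fun_prop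
      exact (ContinuousAt.comp (f := fun y : ℝ => w + y • b) h1 h2).eventually_ne (by simpa using ha)
    filter_upwards [hline hw b, hfd] with y hy hya
    refine ⟨hy, ?_⟩
    have heq : fderiv ℝ g (w + y • b) a • deriv τ (g (w + y • b))
        = fderiv ℝ g w a • deriv τ (g w) := by
      refine (hτdir hy a).unique (((hτdir hw a).add_const
        (τ (g (w + y • b)) - τ (g w))).congr_of_eventuallyEq ?_)
      filter_upwards [hline hw a, hline hy a] with x hx hx'
      have := hmix w x y hw hx hy hx'
      rw [← add_sub_assoc, ← this, add_sub_cancel_right]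
    have := congrArg (c ⬝ᵥ ·) heq
    simpa [dotProduct_smul, hc, hya] using this
  obtain ⟨δ, hδ, hball⟩ := Metric.eventually_nhds_iff.1 hev
  obtain ⟨y, hy, hyδ⟩ : ∃ y : ℝ, g (w + y • b) ≠ g w ∧ |y| < δ := by
    have h1 := (hdir hw b).eventually_ne (c := g w) hb
    have h2 : ∀ᶠ y : ℝ in nhdsWithin 0 {0}ᶜ, |y| < δ :=
      nhdsWithin_le_nhds ((continuous_abs.tendsto' (0 : ℝ) 0 abs_zero).eventually_lt_const hδ)
    exact (h1.and h2).exists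
  have hsmall : ∀ z ∈ uIcc 0 y, w + z • b ∈ N ∧ c ⬝ᵥ deriv τ (g (w + z • b)) = 0 := by
    intro z hz
    refine hball ?_
    rw [dist_zero_right, Real.norm_eq_abs]
    have := abs_sub_left_of_mem_uIcc hz
    simp only [sub_zero] at this
    exact this.trans_lt hyδ
  have hγ : ContinuousOn (fun z : ℝ => g (w + z • b)) (uIcc 0 y) :=
    hg.continuousOn.comp (by fun_prop) fun z hz => (hsmall z hz).1
  have hivt := intermediate_value_uIcc hγ
  have hzero : ∀ x ∈ uIcc (g w) (g (w + y • b)), x ∈ I ∧ c ⬝ᵥ deriv τ x = 0 := by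
    intro x hx
    obtain ⟨z, hz, rfl⟩ := hivt (by simpa using hx)
    exact ⟨hgI (hsmall z hz).1, (hsmall z hz).2⟩
  set p := min (g w) (g (w + y • b))
  set q := max (g w) (g (w + y • b))
  have hpq : p < q := min_lt_max.2 (Ne.symm hy)
  have hsub : Ioo p q ⊆ uIcc (g w) (g (w + y • b)) := Ioo_subset_Icc_self
  have hd : ∀ x ∈ Ioo p q, HasDerivAt (fun x => c ⬝ᵥ τ x) 0 x := by
    intro x hx
    obtain ⟨hxI, hx0⟩ := hzero x (hsub hx)
    rw [← hx0]
    refine HasDerivAt.fun_sum fun j _ => ?_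
    exact ((hasDerivAt_pi.1 (hτ x hxI).hasDerivAt) j).const_mul (c j)
  obtain ⟨m, hm⟩ := nonempty_Ioo.2 hpq
  refine hc0 (hmin p q hpq (fun x hx => (hzero x (hsub hx)).1) c (c ⬝ᵥ τ m) fun x hx => ?_)
  exact isOpen_Ioo.is_const_of_deriv_eq_zero isPreconnected_Ioo
    (fun z hz => (hd z hz).differentiableAt.differentiableWithinAt) (fun z hz => (hd z hz).deriv)
    hx hm

/-! ### Diffeomorphisms between boxes that act coordinatewise -/

section Box

variable {ι : Type*}

/-- The product of the sets `I i`, as a subset of Euclidean space. -/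
def euclideanBox (I : ι → Set ℝ) : Set (EuclideanSpace ℝ ι) := {u | ∀ i, u i ∈ I i}

theorem isOpen_euclideanBox [Finite ι] {I : ι → Set ℝ} (hI : ∀ i, IsOpen (I i)) :
    IsOpen (euclideanBox I) := by
  have : euclideanBox I = ⋂ i, (fun u : EuclideanSpace ℝ ι => u i) ⁻¹' I i := by
    ext; simp [euclideanBox]
  rw [this]
  exact isOpen_iInter_of_finite fun i => (hI i).preimage (by fun_prop)

theorem convex_euclideanBox {I : ι → Set ℝ} (hI : ∀ i, (I i).OrdConnected) :
    Convex ℝ (euclideanBox I) := fun _ hu _ hw _ _ ha hb hab i =>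
  (hI i).convex (hu i) (hw i) ha hb hab

theorem nonempty_euclideanBox {I : ι → Set ℝ} (hI : ∀ i, (I i).Nonempty) :
    (euclideanBox I).Nonempty := by
  choose x hx using hI
  exact ⟨WithLp.toLp 2 x, hx⟩

variable [DecidableEq ι]

/-- The point `u` with its `i`-th coordinate replaced by `x`. -/
noncomputable def replaceCoord (u : EuclideanSpace ℝ ι) (i : ι) (x : ℝ) : EuclideanSpace ℝ ι :=
  u + (x - u i) • EuclideanSpace.single i 1

theorem replaceCoord_self (u : EuclideanSpace ℝ ι) (i : ι) (x : ℝ) : replaceCoord u i x i = x := by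
  simp [replaceCoord]

theorem replaceCoord_of_ne (u : EuclideanSpace ℝ ι) {i j : ι} (h : j ≠ i) (x : ℝ) :
    replaceCoord u i x j = u j := by
  simp [replaceCoord, h]

theorem replaceCoord_mem {I : ι → Set ℝ} {u : EuclideanSpace ℝ ι} (hu : u ∈ euclideanBox I) {i : ι}
    {x : ℝ} (hx : x ∈ I i) : replaceCoord u i x ∈ euclideanBox I := fun j => by
  by_cases h : j = i
  · subst h; rwa [replaceCoord_self]
  · rw [replaceCoord_of_ne u h]; exact hu j

variable [Fintype ι]

theorem contDiff_replaceCoord (u : EuclideanSpace ℝ ι) (i : ι) : ContDiff ℝ 1 (replaceCoord u i) := by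
  unfold replaceCoord
  fun_prop

theorem clm_apply_eq_sum (A : EuclideanSpace ℝ ι →L[ℝ] EuclideanSpace ℝ ι)
    (z : EuclideanSpace ℝ ι) (i : ι) :
    A z i = ∑ s, z s * A (EuclideanSpace.single s 1) i := by
  have hz : z = ∑ s, z s • EuclideanSpace.single s (1 : ℝ) := by
    ext j
    simp [Pi.single_apply]
  conv_lhs => rw [hz]
  simp

/-- If each row of the Jacobian matrix of a diffeomorphism `ψ` between boxes has at most one nonzero
entry at every point, then the position of this entry is constant by connectedness, and each
coordinate of `ψ` depends on a single coordinate of the argument. -/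
theorem exists_perm_of_fderiv_mul_eq_zero {I' : ι → Set ℝ} (hI' : ∀ i, IsOpen (I' i))
    (hIc' : ∀ i, (I' i).OrdConnected) (hIn' : ∀ i, (I' i).Nonempty)
    {ψ : EuclideanSpace ℝ ι → EuclideanSpace ℝ ι} (hψ : ContDiffOn ℝ 1 ψ (euclideanBox I'))
    (hsurj : ∀ w ∈ euclideanBox I', Function.Surjective (fderiv ℝ ψ w))
    (hzero : ∀ w ∈ euclideanBox I', ∀ i s t, s ≠ t →
      fderiv ℝ ψ w (EuclideanSpace.single s 1) i * fderiv ℝ ψ w (EuclideanSpace.single t 1) i = 0) :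
    ∃ σ : Equiv.Perm ι, ∀ i, ∀ w ∈ euclideanBox I', ∀ z ∈ euclideanBox I',
      w (σ i) = z (σ i) → ψ w i = ψ z i := by
  have hopen := isOpen_euclideanBox hI'
  have hconv := convex_euclideanBox hIc'
  obtain ⟨w₀, hw₀⟩ := nonempty_euclideanBox hIn'
  set J : EuclideanSpace ℝ ι → ι → ι → ℝ :=
    fun w i s => fderiv ℝ ψ w (EuclideanSpace.single s 1) i with hJ
  have hJc : ∀ i s, ContinuousOn (fun w => J w i s) (euclideanBox I') := fun i s => by
    have h1 := (hψ.continuousOn_fderiv_of_isOpen hopen le_rfl).clm_apply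
      (continuousOn_const (c := EuclideanSpace.single s (1 : ℝ)))
    exact (EuclideanSpace.proj (𝕜 := ℝ) i).continuous.comp_continuousOn h1
  have hJo : ∀ i s, IsOpen (euclideanBox I' ∩ {w | J w i s ≠ 0}) := fun i s =>
    (hJc i s).isOpen_inter_preimage hopen isOpen_ne
  have hrow : ∀ w ∈ euclideanBox I', ∀ i, ∃ s, J w i s ≠ 0 := by
    intro w hw i
    by_contra! hall
    obtain ⟨z, hz⟩ := hsurj w hw (EuclideanSpace.single i 1)
    have h1 := clm_apply_eq_sum (fderiv ℝ ψ w) z i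
    rw [hz] at h1
    simp only [hJ] at hall
    simp [hall] at h1
  have hconst : ∀ i, ∃ s, ∀ w ∈ euclideanBox I', J w i s ≠ 0 := by
    intro i
    obtain ⟨s, hs⟩ := hrow w₀ hw₀ i
    refine ⟨s, fun w hw => ?_⟩
    refine (hconv.isPreconnected.subset_left_of_subset_union (hJo i s)
      (isOpen_biUnion fun t (_ : t ∈ {t | t ≠ s}) => hJo i t) ?_ ?_ ⟨w₀, hw₀, hw₀, hs⟩ hw).2
    · rw [disjoint_left]
      rintro z ⟨hz, hzs⟩ hz'
      obtain ⟨t, hts, -, hzt⟩ := mem_iUnion₂.1 hz'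
      exact mul_ne_zero hzs hzt (hzero z hz i s t (Ne.symm hts))
    · intro z hz
      obtain ⟨t, ht⟩ := hrow z hz i
      by_cases hts : t = s
      · exact Or.inl ⟨hz, hts ▸ ht⟩
      · exact Or.inr (mem_iUnion₂.2 ⟨t, hts, hz, ht⟩)
  choose σ hσ using hconst
  have happ : ∀ w ∈ euclideanBox I', ∀ z i, fderiv ℝ ψ w z i = z (σ i) * J w i (σ i) := by
    intro w hw z i
    rw [clm_apply_eq_sum]
    refine Finset.sum_eq_single (σ i) (fun t _ ht => ?_) (by simp)
    rcases mul_eq_zero.1 (hzero w hw i _ _ ht) with h | h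
    · rw [h, mul_zero]
    · exact (hσ i w hw h).elim
  have hinj : Function.Injective σ := by
    intro i j hij
    by_contra hne
    obtain ⟨z, hz⟩ := hsurj w₀ hw₀ (EuclideanSpace.single i 1)
    have h1 := happ w₀ hw₀ z i
    have h2 := happ w₀ hw₀ z j
    rw [hz] at h1 h2
    rw [← hij] at h2
    have h3 : z (σ i) = 0 := by
      have h0 : z (σ i) * J w₀ j (σ i) = 0 := by
        rw [← h2]; simp [Ne.symm hne]
      exact (mul_eq_zero.1 h0).resolve_right (by rw [hij]; exact hσ j w₀ hw₀)
    simp [h3] at h1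
  refine ⟨Equiv.ofBijective σ (Finite.injective_iff_bijective.1 hinj), fun i w hw z hz hwz => ?_⟩
  have hmem : ∀ t ∈ Icc (0 : ℝ) 1, w + t • (z - w) ∈ euclideanBox I' := fun t ht =>
    hconv.add_smul_sub_mem hw hz ht
  have hd : ∀ t ∈ Icc (0 : ℝ) 1, HasDerivAt (fun t : ℝ => ψ (w + t • (z - w)) i) 0 t := by
    intro t ht
    have h1 := ((hψ.contDiffAt (hopen.mem_nhds (hmem t ht))).differentiableAt
      one_ne_zero).hasFDerivAt
    have h2 : HasDerivAt (fun t : ℝ => w + t • (z - w)) (z - w) t := by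
      simpa using ((hasDerivAt_id t).smul_const (z - w)).const_add w
    have h3 := (EuclideanSpace.proj (𝕜 := ℝ) i).hasFDerivAt.comp_hasDerivAt t
      (h1.comp_hasDerivAt t h2)
    refine h3.congr_deriv ?_
    change fderiv ℝ ψ (w + t • (z - w)) (z - w) i = 0
    rw [happ _ (hmem t ht)]
    have : (z - w) (σ i) = 0 := by
      rw [PiLp.sub_apply, sub_eq_zero]
      exact hwz.symm
    rw [this, zero_mul]
  have := constant_of_has_deriv_right_zero
    (fun t ht => (hd t ht).continuousAt.continuousWithinAt)
    (fun t ht => (hd t (Ico_subset_Icc_self ht)).hasDerivWithinAt) 1 (right_mem_Icc.2 zero_le_one)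
  simpa using this.symm

/-- A diffeomorphism `φ` between boxes whose inverse `ψ` has at most one nonzero entry in each row
of its Jacobian matrix is, up to a permutation, a product of diffeomorphisms of intervals. -/
theorem exists_perm_componentwise {I I' : ι → Set ℝ} (hI : ∀ i, IsOpen (I i))
    (hIn : ∀ i, (I i).Nonempty) (hI' : ∀ i, IsOpen (I' i)) (hIc' : ∀ i, (I' i).OrdConnected)
    (hIn' : ∀ i, (I' i).Nonempty) {φ ψ : EuclideanSpace ℝ ι → EuclideanSpace ℝ ι}
    (hφ : ContDiffOn ℝ 1 φ (euclideanBox I)) (hψ : ContDiffOn ℝ 1 ψ (euclideanBox I'))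
    (hφm : MapsTo φ (euclideanBox I) (euclideanBox I'))
    (hψm : MapsTo ψ (euclideanBox I') (euclideanBox I))
    (hinv : InvOn ψ φ (euclideanBox I) (euclideanBox I'))
    (hzero : ∀ w ∈ euclideanBox I', ∀ i s t, s ≠ t →
      fderiv ℝ ψ w (EuclideanSpace.single s 1) i * fderiv ℝ ψ w (EuclideanSpace.single t 1) i = 0) :
    ∃ (σ : Equiv.Perm ι) (h g : ι → ℝ → ℝ),
      (∀ u ∈ euclideanBox I, ∀ i, φ u (σ i) = h i (u i)) ∧
      (∀ w ∈ euclideanBox I', ∀ i, ψ w i = g i (w (σ i))) ∧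
      ∀ i, MapsTo (h i) (I i) (I' (σ i)) ∧ MapsTo (g i) (I' (σ i)) (I i) ∧
        InvOn (g i) (h i) (I i) (I' (σ i)) ∧ ContDiffOn ℝ 1 (h i) (I i) ∧
        ContDiffOn ℝ 1 (g i) (I' (σ i)) ∧ ∀ x ∈ I i, deriv (h i) x ≠ 0 := by
  have hoI := isOpen_euclideanBox hI
  have hoI' := isOpen_euclideanBox hI'
  obtain ⟨u₀, hu₀⟩ := nonempty_euclideanBox hIn
  obtain ⟨w₀, hw₀⟩ := nonempty_euclideanBox hIn'
  have hsurj : ∀ w ∈ euclideanBox I', Function.Surjective (fderiv ℝ ψ w) := by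
    intro w hw z
    have h1 := ((hφ.contDiffAt (hoI.mem_nhds (hψm hw))).differentiableAt one_ne_zero).hasFDerivAt
    have h2 : HasFDerivAt ψ (fderiv ℝ ψ w) (φ (ψ w)) := by
      rw [hinv.2 hw]
      exact ((hψ.contDiffAt (hoI'.mem_nhds hw)).differentiableAt one_ne_zero).hasFDerivAt
    have h3 : HasFDerivAt (fun u => ψ (φ u)) (ContinuousLinearMap.id ℝ _) (ψ w) := by
      refine (hasFDerivAt_id _).congr_of_eventuallyEq ?_
      filter_upwards [hoI.mem_nhds (hψm hw)] with u hu using hinv.1 hu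
    have h4 := (h2.comp _ h1).unique h3
    exact ⟨fderiv ℝ φ (ψ w) z, DFunLike.congr_fun h4 z⟩
  obtain ⟨σ, hσ⟩ := exists_perm_of_fderiv_mul_eq_zero hI' hIc' hIn' hψ hsurj hzero
  -- the same dependence for `φ`: replacing `φ u (σ i)` by `φ z (σ i)` does not change `ψ (φ u)`
  have hσ' : ∀ i, ∀ u ∈ euclideanBox I, ∀ z ∈ euclideanBox I, u i = z i → φ u (σ i) = φ z (σ i) := by
    intro i u hu z hz huz
    have hmem := replaceCoord_mem (hφm hu) (hφm hz (σ i))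
    have heq : ψ (replaceCoord (φ u) (σ i) (φ z (σ i))) = ψ (φ u) := by
      ext j
      by_cases hj : j = i
      · subst hj
        rw [hσ j _ hmem _ (hφm hz) (replaceCoord_self _ _ _), hinv.1 hu, hinv.1 hz, huz]
      · exact hσ j _ hmem _ (hφm hu) (replaceCoord_of_ne _ (σ.injective.ne hj) _)
    have := hinv.2.injOn hmem (hφm hu) heq
    rw [← this, replaceCoord_self]
  set h : ι → ℝ → ℝ := fun i x => φ (replaceCoord u₀ i x) (σ i) with hh
  set g : ι → ℝ → ℝ := fun i y => ψ (replaceCoord w₀ (σ i) y) i with hg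
  have hφh : ∀ u ∈ euclideanBox I, ∀ i, φ u (σ i) = h i (u i) := fun u hu i =>
    hσ' i u hu _ (replaceCoord_mem hu₀ (hu i)) (replaceCoord_self _ _ _).symm
  have hψg : ∀ w ∈ euclideanBox I', ∀ i, ψ w i = g i (w (σ i)) := fun w hw i =>
    hσ i w hw _ (replaceCoord_mem hw₀ (hw (σ i))) (replaceCoord_self _ _ _).symm
  refine ⟨σ, h, g, hφh, hψg, fun i => ?_⟩
  have hleft : LeftInvOn (g i) (h i) (I i) := fun x hx => by
    have hmem := replaceCoord_mem hu₀ hx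
    change g i (φ (replaceCoord u₀ i x) (σ i)) = x
    rw [← hψg _ (hφm hmem), hinv.1 hmem, replaceCoord_self]
  have hright : RightInvOn (g i) (h i) (I' (σ i)) := fun y hy => by
    have hmem := replaceCoord_mem hw₀ hy
    change h i (ψ (replaceCoord w₀ (σ i) y) i) = y
    rw [← hφh _ (hψm hmem), hinv.2 hmem, replaceCoord_self]
  have hhm : MapsTo (h i) (I i) (I' (σ i)) := fun x hx => hφm (replaceCoord_mem hu₀ hx) (σ i)
  have hgm : MapsTo (g i) (I' (σ i)) (I i) := fun y hy => hψm (replaceCoord_mem hw₀ hy) i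
  have hhC : ContDiffOn ℝ 1 (h i) (I i) :=
    (EuclideanSpace.proj (𝕜 := ℝ) (σ i)).contDiff.comp_contDiffOn
      (hφ.comp (contDiff_replaceCoord u₀ i).contDiffOn fun x hx => replaceCoord_mem hu₀ hx)
  have hgC : ContDiffOn ℝ 1 (g i) (I' (σ i)) :=
    (EuclideanSpace.proj (𝕜 := ℝ) i).contDiff.comp_contDiffOn
      (hψ.comp (contDiff_replaceCoord w₀ (σ i)).contDiffOn fun x hx => replaceCoord_mem hw₀ hx)
  refine ⟨hhm, hgm, ⟨hleft, hright⟩, hhC, hgC, fun x hx h0 => ?_⟩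
  have h1 := ((hhC.contDiffAt ((hI i).mem_nhds hx)).differentiableAt one_ne_zero).hasDerivAt
  have h2 := ((hgC.contDiffAt ((hI' (σ i)).mem_nhds (hhm hx))).differentiableAt
    one_ne_zero).hasDerivAt
  have h3 : HasDerivAt (fun x => g i (h i x)) 1 x := by
    refine (hasDerivAt_id x).congr_of_eventuallyEq ?_
    filter_upwards [(hI i).mem_nhds hx] with z hz using hleft hz
  have h4 := (h2.comp x h1).unique h3
  rw [h0, mul_zero] at h4
  exact zero_ne_one h4

end Box

/-! ### Deconvolution and change of variables -/

/-- Convolution with a measure whose characteristic function is almost everywhere nonzero is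
injective on finite measures. -/
theorem eq_of_conv_eq_of_charFun_ne_zero {E : Type*} [NormedAddCommGroup E] [InnerProductSpace ℝ E]
    [FiniteDimensional ℝ E] [MeasurableSpace E] [BorelSpace E] {ν P P' : Measure E}
    [IsFiniteMeasure ν] [IsFiniteMeasure P] [IsFiniteMeasure P']
    (hν : volume {t | charFun ν t = 0} = 0) (h : Measure.conv ν P = Measure.conv ν P') :
    P = P' := by
  have : CompleteSpace E := FiniteDimensional.complete ℝ E
  refine Measure.ext_of_charFun ?_
  refine (continuous_charFun.ae_eq_iff_eq volume continuous_charFun).1 ?_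
  have hne : ∀ᵐ t, charFun ν t ≠ 0 := by simpa [ae_iff] using hν
  filter_upwards [hne] with t ht
  have := congrArg (charFun · t) h
  simp only [charFun_conv] at this
  exact mul_left_cancel₀ ht this

theorem densityMeasure_conv {D : ℕ} {p : EuclideanSpace ℝ (Fin D) → ℝ} (hp : Measurable p)
    (P : Measure (EuclideanSpace ℝ (Fin D))) [SFinite P] [SFinite (densityMeasure p)] :
    Measure.conv (densityMeasure p) P
      = volume.withDensity fun x => ∫⁻ y, ENNReal.ofReal (p (x - y)) ∂P := by
  ext s hs
  have hind : Measurable (s.indicator (1 : EuclideanSpace ℝ (Fin D) → ENNReal)) :=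
    measurable_one.indicator hs
  rw [← lintegral_indicator_one hs, Measure.lintegral_conv hind, withDensity_apply _ hs,
    lintegral_lintegral_swap (by fun_prop), ← lintegral_indicator hs]
  calc ∫⁻ y, ∫⁻ x, s.indicator 1 (x + y) ∂densityMeasure p ∂P
      = ∫⁻ y, ∫⁻ x, s.indicator 1 x * ENNReal.ofReal (p (x - y)) ∂volume ∂P := by
        refine lintegral_congr fun y => ?_
        rw [densityMeasure, lintegral_withDensity_eq_lintegral_mul _ (by fun_prop) (by fun_prop),
          ← lintegral_sub_right_eq_self _ y]
        simp [mul_comm]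
    _ = ∫⁻ x, s.indicator (fun x => ∫⁻ y, ENNReal.ofReal (p (x - y)) ∂P) x := by
        rw [lintegral_lintegral_swap (by fun_prop)]
        refine lintegral_congr fun x => ?_
        by_cases hx : x ∈ s <;> simp [hx]

/-- Two densities, on `U` and on `U'`, with the same image under injective continuous maps `f` and
`f'` are related by the change of variables formula for the transition map `φ = f'⁻¹ ∘ f`. -/
theorem ae_eq_det_mul_of_map_eq {E F : Type*} [NormedAddCommGroup E] [NormedSpace ℝ E]
    [FiniteDimensional ℝ E] [MeasurableSpace E] [BorelSpace E] (μ : Measure E)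
    [μ.IsAddHaarMeasure] [TopologicalSpace F] [T2Space F] [MeasurableSpace F]
    [BorelSpace F] [SecondCountableTopology F] {f f' : E → F} {U U' : Set E} (hU : IsOpen U)
    (hU' : IsOpen U')
    (hf : ContinuousOn f U) (hf' : ContinuousOn f' U') (hfi : InjOn f U) (hfi' : InjOn f' U')
    {φ ψ : E → E} (hφ : ContDiffOn ℝ 1 φ U) (hψ : DifferentiableOn ℝ ψ U') (hmaps : MapsTo φ U U')
    (hcomp : ∀ u ∈ U, f' (φ u) = f u) (hleft : LeftInvOn ψ φ U) {p p' : E → ENNReal}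
    (hp : AEMeasurable p (μ.restrict U)) (hp' : AEMeasurable p' (μ.restrict U'))
    (hmap : ((μ.restrict U).withDensity p).map f = ((μ.restrict U').withDensity p').map f') :
    p =ᵐ[μ.restrict U] fun u => ENNReal.ofReal |(fderiv ℝ φ u).det| * p' (φ u) := by
  have hdiff : ∀ u ∈ U, HasFDerivAt φ (fderiv ℝ φ u) u := fun u hu =>
    ((hφ.contDiffAt (hU.mem_nhds hu)).differentiableAt one_ne_zero).hasFDerivAt
  have hφm : AEMeasurable φ (μ.restrict U) := hφ.continuousOn.aemeasurable hU.measurableSet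
  have hp'φ : AEMeasurable (fun u => p' (φ u)) (μ.restrict U) := by
    refine ⟨fun u => hp'.mk p' (hφm.mk φ u),
      hp'.measurable_mk.comp hφm.measurable_mk, ?_⟩
    have h1 : ∀ᵐ u ∂μ.restrict U, p' (φ u) = hp'.mk p' (φ u) := by
      have hnull : μ {w | w ∈ U' ∧ p' w ≠ hp'.mk p' w} = 0 := by
        have := (ae_restrict_iff' hU'.measurableSet).1 hp'.ae_eq_mk
        simpa [ae_iff] using this
      have himg := addHaar_image_eq_zero_of_differentiableOn_of_addHaar_eq_zero μ
        (hψ.mono fun w hw => hw.1) hnull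
      rw [ae_restrict_iff' hU.measurableSet, ae_iff]
      refine measure_mono_null (fun u hu => ?_) himg
      simp only [mem_ofPred_eq, Classical.not_imp] at hu
      exact ⟨φ u, ⟨hmaps hu.1, hu.2⟩, hleft hu.1⟩
    filter_upwards [h1, hφm.ae_eq_mk] with u hu hu'
    rw [hu, hu']
  have hdet : AEMeasurable (fun u => ENNReal.ofReal |(fderiv ℝ φ u).det|) (μ.restrict U) := by
    have hc : ContinuousOn (fun u => |(fderiv ℝ φ u).det|) U :=
      (ContinuousLinearMap.continuous_det.comp_continuousOn
        (hφ.continuousOn_fderiv_of_isOpen hU le_rfl)).abs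
    exact (hc.aemeasurable hU.measurableSet).ennreal_ofReal
  refine ae_eq_of_forall_setLIntegral_eq_of_sigmaFinite₀ hp (hdet.mul hp'φ) fun s hs _ => ?_
  rw [Measure.restrict_restrict hs]
  -- the mass of a measurable subset is that of its image under the injective map
  have key : ∀ {g : E → F} {W B : Set E} {q : E → ENNReal}, IsOpen W → ContinuousOn g W →
      InjOn g W → MeasurableSet B → B ⊆ W →
      ((μ.restrict W).withDensity q).map g (g '' B) = ∫⁻ u in B, q u ∂μ := by
    intro g W B q hW hg hgi hB hBW
    have hae : AEMeasurable g ((μ.restrict W).withDensity q) :=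
      (hg.aemeasurable hW.measurableSet).mono_ac (withDensity_absolutelyContinuous _ _)
    rw [Measure.map_apply_of_aemeasurable hae
      (hB.image_of_continuousOn_injOn (hg.mono hBW) (hgi.mono hBW))]
    have hset : g ⁻¹' (g '' B) =ᵐ[(μ.restrict W).withDensity q] B := by
      have hmem : ∀ᵐ u ∂(μ.restrict W).withDensity q, u ∈ W :=
        (withDensity_absolutelyContinuous _ _).ae_le (ae_restrict_mem hW.measurableSet)
      filter_upwards [hmem] with u hu
      refine propext ⟨?_, fun h => mem_image_of_mem g h⟩
      rintro ⟨z, hz, hzu⟩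
      rwa [← hgi (hBW hz) hu hzu]
    rw [measure_congr hset, withDensity_apply _ hB, Measure.restrict_restrict hB,
      inter_eq_left.2 hBW]
  have hB : MeasurableSet (s ∩ U) := hs.inter hU.measurableSet
  have hφB : ∀ u ∈ s ∩ U, HasFDerivWithinAt φ (fderiv ℝ φ u) (s ∩ U) u := fun u hu =>
    (hdiff u hu.2).hasFDerivWithinAt
  have hinj : InjOn φ (s ∩ U) := hleft.injOn.mono inter_subset_right
  have himage : f '' (s ∩ U) = f' '' (φ '' (s ∩ U)) := by
    rw [image_image]
    exact image_congr fun u hu => (hcomp u hu.2).symm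
  rw [← key hU hf hfi hB inter_subset_right, hmap, himage, key hU' hf' hfi'
    (measurable_image_of_fderivWithin hB hφB hinj)
    ((image_mono inter_subset_right).trans hmaps.image_subset),
    lintegral_image_eq_lintegral_abs_det_fderiv_mul μ hB hφB hinj]

/-! ### From the observations to the sufficient statistics -/

namespace LatentModel

variable {ι : Type*} [Fintype ι] {D : ℕ} {V : Type*} {θ θ' : LatentModel ι D V}

theorem isOpen_latentSpace (hexp : θ.IsExpFamily) : IsOpen θ.latentSpace :=
  isOpen_euclideanBox hexp.isOpen_I

theorem weight_pos (hexp : θ.IsExpFamily) (v : V) {u : EuclideanSpace ℝ ι}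
    (hu : u ∈ θ.latentSpace) : 0 < θ.weight v u :=
  mul_pos (hexp.Q_pos u hu) (Real.exp_pos _)

theorem normalizer_pos (hexp : θ.IsExpFamily) (v : V) : 0 < θ.normalizer v := by
  have hU := isOpen_latentSpace hexp
  rw [normalizer, setIntegral_pos_iff_support_of_nonneg_ae _ (hexp.normalizable v)]
  · refine (hU.measure_pos volume (nonempty_euclideanBox hexp.nonempty_I)).trans_le
      (measure_mono fun u hu => ⟨(weight_pos hexp v hu).ne', hu⟩)
  · filter_upwards [ae_restrict_mem hU.measurableSet] with u hu using (weight_pos hexp v hu).le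

theorem prior_eq_weight_div (v : V) (u : EuclideanSpace ℝ ι) :
    θ.prior v u = θ.weight v u / θ.normalizer v := by
  rw [prior, weight, div_mul_eq_mul_div]

theorem prior_pos (hexp : θ.IsExpFamily) (v : V) {u : EuclideanSpace ℝ ι}
    (hu : u ∈ θ.latentSpace) : 0 < θ.prior v u := by
  rw [prior_eq_weight_div]
  exact div_pos (weight_pos hexp v hu) (normalizer_pos hexp v)

theorem log_prior (hexp : θ.IsExpFamily) (v : V) {u : EuclideanSpace ℝ ι}
    (hu : u ∈ θ.latentSpace) : Real.log (θ.prior v u)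
      = Real.log (θ.Q u) - Real.log (θ.normalizer v) + θ.stat u ⬝ᵥ θ.lam v := by
  have hQ := (hexp.Q_pos u hu).ne'
  have hC := (normalizer_pos hexp v).ne'
  rw [prior, Real.log_mul (div_ne_zero hQ hC) (Real.exp_ne_zero _), Real.log_exp,
    Real.log_div hQ hC]

theorem integrableOn_prior (hexp : θ.IsExpFamily) (v : V) :
    IntegrableOn (θ.prior v) θ.latentSpace := by
  have : θ.prior v = fun u => θ.weight v u / θ.normalizer v := funext (prior_eq_weight_div v)
  rw [this]
  exact (hexp.normalizable v).div_const _

theorem continuousOn_stat (hexp : θ.IsExpFamily) (hT : θ.TwiceDiffStat) :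
    ContinuousOn θ.stat θ.latentSpace := by
  refine continuousOn_pi.2 fun s => ?_
  rcases s with ⟨i, q⟩ | m
  · have h1 : ContinuousOn (θ.T i) (θ.I i) := fun x hx =>
      (hT i x hx).1.continuousAt.continuousWithinAt
    exact (continuous_apply q).comp_continuousOn
      (h1.comp (by fun_prop : Continuous fun u : EuclideanSpace ℝ ι => u i).continuousOn
        fun u hu => hu i)
  · have h1 := hexp.mlp.continuous_and_finite_affine.1
    exact ((continuous_apply m).comp
      (h1.comp (by fun_prop : Continuous fun u : EuclideanSpace ℝ ι => fun i => u i))).continuousOn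

/-- The conditional law of the latents given the neighbours' covariates. -/
noncomputable def latentLaw (θ : LatentModel ι D V) (v : V) : Measure (EuclideanSpace ℝ ι) :=
  (volume.restrict θ.latentSpace).withDensity fun u => ENNReal.ofReal (θ.prior v u)

theorem isFiniteMeasure_latentLaw (hexp : θ.IsExpFamily) (v : V) :
    IsFiniteMeasure (θ.latentLaw v) :=
  isFiniteMeasure_withDensity_ofReal (integrableOn_prior hexp v).2

theorem withDensity_obsDensity {pε : EuclideanSpace ℝ (Fin D) → ℝ} (hpε : IsProbDensity pε)
    (hexp : θ.IsExpFamily) (hf : ContinuousOn θ.f θ.latentSpace) (v : V) :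
    volume.withDensity (θ.obsDensity pε v)
      = Measure.conv (densityMeasure pε) ((θ.latentLaw v).map θ.f) := by
  have := isFiniteMeasure_latentLaw hexp v
  have hU := (isOpen_latentSpace hexp).measurableSet
  have hm := hpε.measurable
  have : SFinite (densityMeasure pε) := by unfold densityMeasure; infer_instance
  have hac : θ.latentLaw v ≪ volume.restrict θ.latentSpace := withDensity_absolutelyContinuous _ _
  rw [densityMeasure_conv hm]
  congr 1
  ext x
  have hg : Measurable fun y => ENNReal.ofReal (pε (x - y)) := by fun_prop
  have hfm := hf.aemeasurable (μ := volume) hU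
  have hpm : AEMeasurable (fun u => ENNReal.ofReal (θ.prior v u))
      (volume.restrict θ.latentSpace) :=
    (integrableOn_prior hexp v).1.aemeasurable.ennreal_ofReal
  rw [lintegral_map' hg.aemeasurable (hfm.mono_ac hac), latentLaw,
    lintegral_withDensity_eq_lintegral_mul₀ hpm
      (g := fun u => ENNReal.ofReal (pε (x - θ.f u))) (hg.comp_aemeasurable hfm)]
  refine lintegral_congr fun u => ?_
  rw [ENNReal.ofReal_mul (hpε.nonneg _), mul_comm]
  rfl

/-- Equality of the observed densities transports the laws of the noise-free observations. -/
theorem map_latentLaw_eq {pε : EuclideanSpace ℝ (Fin D) → ℝ} (hpε : IsProbDensity pε)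
    (hφ : volume {t | charFun (densityMeasure pε) t = 0} = 0)
    (hexp : θ.IsExpFamily) (hexp' : θ'.IsExpFamily) (hf : ContinuousOn θ.f θ.latentSpace)
    (hf' : ContinuousOn θ'.f θ'.latentSpace) {v : V}
    (hobs : θ'.obsDensity pε v =ᵐ[volume] θ.obsDensity pε v) :
    (θ.latentLaw v).map θ.f = (θ'.latentLaw v).map θ'.f := by
  have := isFiniteMeasure_latentLaw hexp v
  have := isFiniteMeasure_latentLaw hexp' v
  have : IsFiniteMeasure (densityMeasure pε) := by
    refine isFiniteMeasure_withDensity ?_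
    rw [hpε.lintegral_eq_one]
    exact ENNReal.one_ne_top
  refine eq_of_conv_eq_of_charFun_ne_zero hφ ?_
  rw [← withDensity_obsDensity hpε hexp hf, ← withDensity_obsDensity hpε hexp' hf']
  exact (withDensity_congr_ae hobs).symm

/-- If the transition map `φ` between the latent spaces carries the priors of `θ` to those of `θ'`,
the sufficient statistics of `θ` are an affine function of those of `θ'`: in differences of
log-densities the base measures and the Jacobian determinant cancel, and the matrix of differences
of natural parameters can be inverted. -/
theorem exists_stat_eq_mulVec [DecidableEq ι] (hexp : θ.IsExpFamily) (hexp' : θ'.IsExpFamily)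
    (hT : θ.TwiceDiffStat) (hT' : θ'.TwiceDiffStat) (hL : θ.SufficientVariability)
    {φ : EuclideanSpace ℝ ι → EuclideanSpace ℝ ι} (hφ : ContinuousOn φ θ.latentSpace)
    (hmaps : MapsTo φ θ.latentSpace θ'.latentSpace) (d : EuclideanSpace ℝ ι → ℝ)
    (hd : ∀ v, (fun u => ENNReal.ofReal (θ.prior v u)) =ᵐ[volume.restrict θ.latentSpace]
      fun u => ENNReal.ofReal |d u| * ENNReal.ofReal (θ'.prior v (φ u))) :
    ∃ (A : Matrix θ.StatIdx θ'.StatIdx ℝ) (b : θ.StatIdx → ℝ), ∀ u ∈ θ.latentSpace,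
      θ.stat u = A *ᵥ θ'.stat (φ u) + b := by
  obtain ⟨x, -, hx⟩ := hL
  have hU := isOpen_latentSpace hexp
  have hlog : ∀ v, ∀ᵐ u ∂volume.restrict θ.latentSpace,
      Real.log (θ.prior v u) = Real.log |d u| + Real.log (θ'.prior v (φ u)) := by
    intro v
    filter_upwards [hd v, ae_restrict_mem hU.measurableSet] with u hu huU
    have hp := prior_pos hexp v huU
    have hp' := prior_pos hexp' v (hmaps huU)
    rw [← ENNReal.ofReal_mul (abs_nonneg _),
      ENNReal.ofReal_eq_ofReal_iff hp.le (mul_nonneg (abs_nonneg _) hp'.le)] at hu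
    have hd0 : |d u| ≠ 0 := fun h0 => by rw [h0, zero_mul] at hu; exact hp.ne' hu
    rw [hu, Real.log_mul hd0 hp'.ne']
  set L : Matrix θ.StatIdx θ.StatIdx ℝ :=
    Matrix.of fun s l => θ.lam (x (some l)) s - θ.lam (x none) s with hLdef
  set L' : Matrix θ'.StatIdx θ.StatIdx ℝ :=
    Matrix.of fun s l => θ'.lam (x (some l)) s - θ'.lam (x none) s with hLdef'
  set k : θ.StatIdx → ℝ := fun l =>
    Real.log (θ.normalizer (x (some l))) - Real.log (θ.normalizer (x none))
      - (Real.log (θ'.normalizer (x (some l))) - Real.log (θ'.normalizer (x none)))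
  have hcoord : ∀ l, ∀ᵐ u ∂volume.restrict θ.latentSpace,
      (θ.stat u ᵥ* L) l = (θ'.stat (φ u) ᵥ* L' + k) l := by
    intro l
    filter_upwards [hlog (x (some l)), hlog (x none), ae_restrict_mem hU.measurableSet]
      with u h1 h0 huU
    rw [log_prior hexp _ huU, log_prior hexp' _ (hmaps huU)] at h1 h0
    have e1 : (θ.stat u ᵥ* L) l
        = θ.stat u ⬝ᵥ θ.lam (x (some l)) - θ.stat u ⬝ᵥ θ.lam (x none) := by
      rw [← dotProduct_sub]; rfl
    have e2 : (θ'.stat (φ u) ᵥ* L') l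
        = θ'.stat (φ u) ⬝ᵥ θ'.lam (x (some l)) - θ'.stat (φ u) ⬝ᵥ θ'.lam (x none) := by
      rw [← dotProduct_sub]; rfl
    rw [Pi.add_apply, e1, e2]
    simp only [k]
    linarith
  have hae : (fun u => θ.stat u ᵥ* L) =ᵐ[volume.restrict θ.latentSpace]
      fun u => θ'.stat (φ u) ᵥ* L' + k := by
    filter_upwards [ae_all_iff.2 hcoord] with u hu using funext hu
  have hc : ContinuousOn (fun u => θ.stat u ᵥ* L) θ.latentSpace :=
    (by fun_prop : Continuous fun z : θ.StatIdx → ℝ => z ᵥ* L).comp_continuousOn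
      (continuousOn_stat hexp hT)
  have hc' : ContinuousOn (fun u => θ'.stat (φ u) ᵥ* L' + k) θ.latentSpace :=
    (by fun_prop : Continuous fun z : θ'.StatIdx → ℝ => z ᵥ* L' + k).comp_continuousOn
      ((continuousOn_stat hexp' hT').comp hφ hmaps)
  have heq := Measure.eqOn_open_of_ae_eq hae hU hc hc'
  refine ⟨(L' * L⁻¹)ᵀ, k ᵥ* L⁻¹, fun u hu => ?_⟩
  have hinv : L * L⁻¹ = 1 := Matrix.mul_nonsing_inv _ ((Matrix.isUnit_iff_isUnit_det _).1 hx)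
  calc θ.stat u = (θ.stat u ᵥ* L) ᵥ* L⁻¹ := by
        rw [Matrix.vecMul_vecMul, hinv, Matrix.vecMul_one]
    _ = (θ'.stat (φ u) ᵥ* L' + k) ᵥ* L⁻¹ := by
        have h1 := heq hu
        simp only at h1
        rw [h1]
    _ = _ := by rw [Matrix.add_vecMul, Matrix.vecMul_vecMul, Matrix.mulVec_transpose]

/-! ### From the sufficient statistics to the latents -/

/-- Up to the perceptron, the statistic of the `i`-th coordinate, pulled back by the transition map
`ψ`, is a sum of functions of one coordinate each. -/
theorem exists_T_eq_sum {A : Matrix θ.StatIdx θ'.StatIdx ℝ} {b : θ.StatIdx → ℝ}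
    {ψ : EuclideanSpace ℝ ι → EuclideanSpace ℝ ι}
    (hA : ∀ w ∈ θ'.latentSpace, θ.stat (ψ w) = A *ᵥ θ'.stat w + b) (i : ι) :
    ∃ (B : (j : ι) → Matrix (Fin (θ.dimT i)) (Fin (θ'.dimT j)) ℝ)
      (M : Matrix (Fin (θ.dimT i)) (Fin θ'.dimMLP) ℝ) (c : Fin (θ.dimT i) → ℝ),
      ∀ w ∈ θ'.latentSpace, θ.T i (ψ w i)
        = ∑ j, B j *ᵥ θ'.T j (w j) + M *ᵥ θ'.TMLP (fun j => w j) + c := by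
  refine ⟨fun j => Matrix.of fun q m => A (Sum.inl ⟨i, q⟩) (Sum.inl ⟨j, m⟩),
    Matrix.of fun q m => A (Sum.inl ⟨i, q⟩) (Sum.inr m), fun q => b (Sum.inl ⟨i, q⟩),
    fun w hw => funext fun q => ?_⟩
  have h1 := congrFun (hA w hw) (Sum.inl ⟨i, q⟩)
  refine Eq.trans (b := θ.stat (ψ w) (Sum.inl ⟨i, q⟩)) rfl (h1.trans ?_)
  simp [Matrix.mulVec, dotProduct, Fintype.sum_sum_type, Fintype.sum_sigma, stat, Finset.sum_apply]

/-- Each row of the Jacobian matrix of the transition map `ψ` has at most one nonzero entry. Two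
nonzero entries would be nonzero on an open set where the perceptron is affine, so that the mixed
differences of the statistic vanish there. -/
theorem fderiv_mul_fderiv_eq_zero [DecidableEq ι] (hexp : θ.IsExpFamily) (hexp' : θ'.IsExpFamily)
    (hT : θ.TwiceDiffStat) {ψ : EuclideanSpace ℝ ι → EuclideanSpace ℝ ι}
    (hψ : ContDiffOn ℝ 1 ψ θ'.latentSpace) (hψm : MapsTo ψ θ'.latentSpace θ.latentSpace)
    {i : ι} {B : (j : ι) → Matrix (Fin (θ.dimT i)) (Fin (θ'.dimT j)) ℝ}
    {M : Matrix (Fin (θ.dimT i)) (Fin θ'.dimMLP) ℝ} {c : Fin (θ.dimT i) → ℝ}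
    (hB : ∀ w ∈ θ'.latentSpace, θ.T i (ψ w i)
        = ∑ j, B j *ᵥ θ'.T j (w j) + M *ᵥ θ'.TMLP (fun j => w j) + c)
    {s t : ι} (hst : s ≠ t) {w : EuclideanSpace ℝ ι} (hw : w ∈ θ'.latentSpace) :
    fderiv ℝ ψ w (EuclideanSpace.single s 1) i * fderiv ℝ ψ w (EuclideanSpace.single t 1) i
      = 0 := by
  have hU' := isOpen_latentSpace hexp'
  by_contra hne
  have hJc : ∀ s, ContinuousOn (fun w => fderiv ℝ ψ w (EuclideanSpace.single s 1) i)
      θ'.latentSpace := fun s => by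
    have h1 := (hψ.continuousOn_fderiv_of_isOpen hU' le_rfl).clm_apply
      (continuousOn_const (c := EuclideanSpace.single s (1 : ℝ)))
    exact (EuclideanSpace.proj (𝕜 := ℝ) i).continuous.comp_continuousOn h1
  have hO := ((hJc s).mul (hJc t)).isOpen_inter_preimage hU' (isOpen_ne (x := (0 : ℝ)))
  obtain ⟨hgc, S, hS, hsel⟩ := hexp'.mlp.continuous_and_finite_affine
  obtain ⟨p, -, N, hNO, hN, ⟨z, hz⟩, hNp⟩ := exists_open_eqOn_of_finite_selection
    (g := fun w : EuclideanSpace ℝ ι => θ'.TMLP fun j => w j)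
    (hgc.comp (by fun_prop)) (F := fun p w => p.1 *ᵥ (fun j => w j) + p.2)
    (fun p => by fun_prop) hS hO ⟨w, hw, hne⟩ fun u _ => hsel _
  have hNU : N ⊆ θ'.latentSpace := fun u hu => (hNO hu).1
  have hcoord : ∀ u ∈ N, ∀ e, fderiv ℝ (fun w => ψ w i) u e = fderiv ℝ ψ u e i := by
    intro u hu e
    have h1 := ((hψ.contDiffAt (hU'.mem_nhds (hNU hu))).differentiableAt one_ne_zero).hasFDerivAt
    have h2 := (EuclideanSpace.proj (𝕜 := ℝ) i).hasFDerivAt.comp u h1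
    exact DFunLike.congr_fun h2.fderiv e
  have hzero := fderiv_mul_fderiv_eq_zero_of_mixed_difference (hexp.two_le_dimT i) hN
    (g := fun w => ψ w i)
    ((EuclideanSpace.proj (𝕜 := ℝ) i).contDiff.comp_contDiffOn (hψ.mono hNU))
    (τ := θ.T i) (fun u hu => hψm (hNU hu) i) (fun x hx => (hT i x hx).1) (hexp.minimal i)
    (a := EuclideanSpace.single s 1) (b := EuclideanSpace.single t 1) ?_ hz
  · rw [hcoord z hz, hcoord z hz] at hzero
    exact (hNO hz).2 hzero
  intro w x y hw hwx hwy hwyx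
  simp only [hB _ (hNU hw), hB _ (hNU hwx), hB _ (hNU hwy), hB _ (hNU hwyx), hNp _ hw, hNp _ hwx,
    hNp _ hwy, hNp _ hwyx]
  set e : ι → EuclideanSpace ℝ ι → Fin (θ.dimT i) → ℝ := fun j w => B j *ᵥ θ'.T j (w j) with he
  set ws := w + y • EuclideanSpace.single t (1 : ℝ) + x • EuclideanSpace.single s (1 : ℝ) with hws
  have hsep : ∑ j, e j ws + ∑ j, e j w = ∑ j, e j (w + x • EuclideanSpace.single s (1 : ℝ))
      + ∑ j, e j (w + y • EuclideanSpace.single t (1 : ℝ)) := by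
    rw [← Finset.sum_add_distrib, ← Finset.sum_add_distrib]
    refine Finset.sum_congr rfl fun j _ => ?_
    by_cases hj : j = s
    · subst hj
      simp [he, hws, hst]
    · rw [add_comm (e j (w + x • _))]
      simp [he, hws, hj]
  have haff : (p.1 *ᵥ (fun j => ws j) + p.2) + (p.1 *ᵥ (fun j => w j) + p.2)
      = (p.1 *ᵥ (fun j => (w + x • EuclideanSpace.single s (1 : ℝ)) j) + p.2)
        + (p.1 *ᵥ (fun j => (w + y • EuclideanSpace.single t (1 : ℝ)) j) + p.2) := by
    have h1 : (fun j => ws j) + (fun j => w j)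
        = (fun j => (w + x • EuclideanSpace.single s (1 : ℝ)) j)
          + fun j => (w + y • EuclideanSpace.single t (1 : ℝ)) j := by
      ext j
      simp only [hws, Pi.add_apply, PiLp.add_apply]
      ring
    have h2 := congrArg (p.1 *ᵥ ·) h1
    simp only [Matrix.mulVec_add] at h2
    rw [add_add_add_comm, h2, add_add_add_comm]
  have haff' := congrArg (M *ᵥ ·) haff
  simp only [Matrix.mulVec_add M (p.1 *ᵥ _ + p.2)] at haff'
  calc _ = (∑ j, e j ws + ∑ j, e j w) + (M *ᵥ (p.1 *ᵥ (fun j => ws j) + p.2)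
        + M *ᵥ (p.1 *ᵥ (fun j => w j) + p.2)) + (c + c) := by abel
    _ = _ := by rw [hsep, haff']; abel

/-- If the transition map acts on the `i`-th coordinate through `g`, with inverse `h`, the
statistics of the two models are related up to a function that is affine: the perceptron restricted
to a line is a selection of finitely many affine functions, and it is differentiable since the
other terms are. -/
theorem exists_T_eq_affine [DecidableEq ι] (hexp' : θ'.IsExpFamily)
    (hT : θ.TwiceDiffStat) (hT' : θ'.TwiceDiffStat) {ψ : EuclideanSpace ℝ ι → EuclideanSpace ℝ ι}
    {i k : ι} {B : (j : ι) → Matrix (Fin (θ.dimT i)) (Fin (θ'.dimT j)) ℝ}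
    {M : Matrix (Fin (θ.dimT i)) (Fin θ'.dimMLP) ℝ} {b : Fin (θ.dimT i) → ℝ}
    (hB : ∀ w ∈ θ'.latentSpace, θ.T i (ψ w i)
        = ∑ j, B j *ᵥ θ'.T j (w j) + M *ᵥ θ'.TMLP (fun j => w j) + b)
    {g h : ℝ → ℝ} (hψg : ∀ w ∈ θ'.latentSpace, ψ w i = g (w k))
    (hgm : MapsTo g (θ'.I k) (θ.I i)) (hhm : MapsTo h (θ.I i) (θ'.I k))
    (hgh : LeftInvOn g h (θ.I i)) (hg : ContDiffOn ℝ 1 g (θ'.I k)) :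
    ∃ (A : Matrix (Fin (θ.dimT i)) (Fin (θ'.dimT k)) ℝ) (a c : Fin (θ.dimT i) → ℝ),
      ∀ x ∈ θ.I i, θ.T i x = A *ᵥ θ'.T k (h x) + h x • a + c := by
  obtain ⟨w₀, hw₀⟩ := nonempty_euclideanBox hexp'.nonempty_I
  set ω : ℝ → EuclideanSpace ℝ ι := replaceCoord w₀ k with hω
  have hωU : ∀ y ∈ θ'.I k, ω y ∈ θ'.latentSpace := fun y hy => replaceCoord_mem hw₀ hy
  set r : Fin (θ.dimT i) → ℝ :=
    ∑ j ∈ Finset.univ.erase k, B j *ᵥ θ'.T j (w₀ j) with hr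
  set G : ℝ → Fin (θ.dimT i) → ℝ := fun y => M *ᵥ θ'.TMLP (fun j => ω y j) with hG
  have hTG : ∀ y ∈ θ'.I k, θ.T i (g y) = B k *ᵥ θ'.T k y + r + G y + b := by
    intro y hy
    have h1 := hB (ω y) (hωU y hy)
    have hk : ω y k = y := replaceCoord_self _ _ _
    rw [hψg _ (hωU y hy), ← Finset.add_sum_erase _ _ (Finset.mem_univ k), hk] at h1
    have h2 : ∑ j ∈ Finset.univ.erase k, B j *ᵥ θ'.T j (ω y j) = r :=
      Finset.sum_congr rfl fun j hj => by
        rw [hω, replaceCoord_of_ne _ (Finset.ne_of_mem_erase hj)]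
    rw [h1, h2]
  have hGd : ∀ y ∈ θ'.I k, DifferentiableAt ℝ G y := by
    intro y hy
    have h1 : DifferentiableAt ℝ (fun y => θ.T i (g y)) y :=
      DifferentiableAt.comp y (hT i _ (hgm hy)).1
        ((hg.contDiffAt ((hexp'.isOpen_I k).mem_nhds hy)).differentiableAt one_ne_zero)
    have h2 : DifferentiableAt ℝ (fun y => B k *ᵥ θ'.T k y) y :=
      (LinearMap.toContinuousLinearMap (B k).mulVecLin).differentiableAt.comp y (hT' k y hy).1
    refine ((h1.sub h2).sub_const (r + b)).congr_of_eventuallyEq ?_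
    filter_upwards [(hexp'.isOpen_I k).mem_nhds hy] with z hz
    simp only [Pi.sub_apply, hTG z hz]
    abel
  obtain ⟨-, S, hS, hsel⟩ := hexp'.mlp.continuous_and_finite_affine
  have haff : ∀ q, ∃ a c, ∀ y ∈ θ'.I k, G y q = y * a + c := by
    intro q
    refine exists_affine_of_finite_selection (hexp'.isOpen_I k) (hexp'.ordConnected_I k)
      (fun y hy => differentiableAt_pi.1 (hGd y hy) q)
      (hS.image fun p => ((M *ᵥ (p.1 *ᵥ Pi.single k 1)) q,
        (M *ᵥ (p.1 *ᵥ ((fun j => w₀ j) - w₀ k • Pi.single k 1) + p.2)) q)) fun y => ?_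
    obtain ⟨p, hp, hpy⟩ := hsel fun j => ω y j
    refine ⟨_, ⟨p, hp, rfl⟩, ?_⟩
    have h1 : (fun j => ω y j)
        = y • Pi.single k (1 : ℝ) + ((fun j => w₀ j) - w₀ k • Pi.single k (1 : ℝ)) := by
      ext j
      simp only [hω, replaceCoord, PiLp.add_apply, PiLp.smul_apply, Pi.add_apply, Pi.sub_apply,
        Pi.smul_apply, PiLp.single_apply, Pi.single_apply, smul_eq_mul]
      ring
    simp only [hG]
    rw [hpy, h1, Matrix.mulVec_add p.1, add_assoc, Matrix.mulVec_add M, Matrix.mulVec_smul,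
      Matrix.mulVec_smul, Pi.add_apply, Pi.smul_apply, smul_eq_mul]
  choose a c hac using haff
  refine ⟨B k, a, r + c + b, fun x hx => ?_⟩
  have hGx : G (h x) = h x • a + c := funext fun q => hac q _ (hhm hx)
  rw [← congrArg (θ.T i) (hgh hx), hTG _ (hhm hx), hGx]
  abel

end LatentModel

theorem theorem1 {dI dC dN D : ℕ} {V : Type*}
    (pε : EuclideanSpace ℝ (Fin D) → ℝ) (hpε : IsProbDensity pε)
    (hφ : volume {t | charFun (densityMeasure pε) t = 0} = 0)
    (θ θ' : LatentModel (Fin dI ⊕ Fin dC ⊕ Fin dN) D V)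
    (hexp : θ.IsExpFamily) (hexp' : θ'.IsExpFamily)
    (hf : θ.IsRegularMixing) (hf' : θ'.IsRegularMixing)
    (hT : θ.TwiceDiffStat) (hT' : θ'.TwiceDiffStat)
    (hL : θ.SufficientVariability)
    (hrange : θ'.f '' θ'.latentSpace = θ.f '' θ.latentSpace)
    (hobs : ∀ v : V, θ'.obsDensity pε v =ᵐ[volume] θ.obsDensity pε v) :
    ∃ (σ : Equiv.Perm (Fin dI ⊕ Fin dC ⊕ Fin dN)) (h : Fin dI ⊕ Fin dC ⊕ Fin dN → ℝ → ℝ),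
      (∀ i, BijOn (h i) (θ.I i) (θ'.I (σ i)) ∧ ContDiffOn ℝ 1 (h i) (θ.I i) ∧
        ∀ x ∈ θ.I i, deriv (h i) x ≠ 0) ∧
      (∀ i, ∃ (A : Matrix (Fin (θ.dimT i)) (Fin (θ'.dimT (σ i))) ℝ) (a c : Fin (θ.dimT i) → ℝ),
        ∀ x ∈ θ.I i, θ.T i x = A *ᵥ θ'.T (σ i) (h i x) + h i x • a + c) ∧
      ∀ u ∈ θ.latentSpace, ∃ u' ∈ θ'.latentSpace, θ'.f u' = θ.f u ∧
        ∀ i, u' (σ i) = h i (u i) := by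
  have hU := LatentModel.isOpen_latentSpace hexp
  have hU' := LatentModel.isOpen_latentSpace hexp'
  obtain ⟨φ, hφm, hφf, hφC⟩ := exists_contDiffOn_transition hU hU' hf.contDiffOn hf'.contDiffOn
    hf'.immersion hf'.inducing hrange.ge
  obtain ⟨ψ, hψm, hψf, hψC⟩ := exists_contDiffOn_transition hU' hU hf'.contDiffOn hf.contDiffOn
    hf.immersion hf.inducing hrange.le
  have hinv : InvOn ψ φ θ.latentSpace θ'.latentSpace :=
    ⟨fun u hu => hf.injOn (hψm (hφm hu)) hu ((hψf _ (hφm hu)).trans (hφf u hu)),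
      fun w hw => hf'.injOn (hφm (hψm hw)) hw ((hφf _ (hψm hw)).trans (hψf w hw))⟩
  obtain ⟨A, b, hA⟩ := LatentModel.exists_stat_eq_mulVec hexp hexp' hT hT' hL hφC.continuousOn hφm
    (fun u => (fderiv ℝ φ u).det) fun v => ae_eq_det_mul_of_map_eq volume hU hU'
      hf.contDiffOn.continuousOn hf'.contDiffOn.continuousOn hf.injOn hf'.injOn hφC
      (hψC.differentiableOn one_ne_zero) hφm hφf hinv.1
      (LatentModel.integrableOn_prior hexp v).1.aemeasurable.ennreal_ofReal
      (LatentModel.integrableOn_prior hexp' v).1.aemeasurable.ennreal_ofReal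
      (LatentModel.map_latentLaw_eq hpε hφ hexp hexp' hf.contDiffOn.continuousOn
        hf'.contDiffOn.continuousOn (hobs v))
  have hA' : ∀ w ∈ θ'.latentSpace, θ.stat (ψ w) = A *ᵥ θ'.stat w + b := fun w hw => by
    rw [hA _ (hψm hw), hinv.2 hw]
  choose B M c hB using fun i => LatentModel.exists_T_eq_sum hA' i
  obtain ⟨σ, h, g, hφh, hψg, hhg⟩ := exists_perm_componentwise hexp.isOpen_I hexp.nonempty_I
    hexp'.isOpen_I hexp'.ordConnected_I hexp'.nonempty_I hφC hψC hφm hψm hinv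
    fun w hw i s t hst => LatentModel.fderiv_mul_fderiv_eq_zero hexp hexp' hT hψC hψm (hB i) hst hw
  refine ⟨σ, h, fun i => ?_, fun i => ?_, fun u hu => ⟨φ u, hφm hu, hφf u hu, hφh u hu⟩⟩
  · obtain ⟨hhm, hgm, hgh, hhC, -, hh0⟩ := hhg i
    exact ⟨hgh.bijOn hhm hgm, hhC, hh0⟩
  · obtain ⟨hhm, hgm, hgh, -, hgC, -⟩ := hhg i
    exact LatentModel.exists_T_eq_affine hexp' hT hT' (hB i) (fun w hw => hψg w hw i) hgm hhm
      hgh.1 hgC
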